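/- **Setting.** A *noisy oracle* to a bit $b\in\{0,1\}$, called with a parameter $\gamma\in[0,1]$, returns an independent random bit that equals $b$ with probability $\frac{1+\gamma}{2}$; such a call costs $\gamma^2$. Let $n\ge 1$. A *noisy oracle decision tree* on $n$ bits is a finite binary tree whose internal nodes are labelled by pairs $(i,\gamma)$ with $i\in[n]$, $\gamma\in[0,1]$, and whose leaves are labelled by outputs. On input $x\in\{0,1\}^n$ one walks from the root to a leaf; at a node $(i,\gamma)$ one calls the noisy oracle for $x_i$ with parameter $\gamma$ and goes left if the answer is $0$ and right if it is $1$. A *noisy oracle algorithm* $R$ is a finitely supported probability distribution over such trees; $R(x)$ denotes its random output on $x$, and $\mathrm{cost}(R,x)$ the expected total cost of its oracle calls on $x$. A relation is a set $f\subseteq\{0,1\}^n\times\Sigma$ with $\Sigma$ finite; $\mathrm{Dom}(f)$ is the set of $x$ for which the set $f_x=\{\sigma:(x,\sigma)\in f\}$ of allowed outputs is nonempty. An algorithm $R$ computes $f$ to error $\epsilon$ if $\Pr[R(x)\in f_x]\ge 1-\epsilon$ for all $x\in\mathrm{Dom}(f)$. Its worst-case expected cost is $\max_{x\in\mathrm{Dom}(f)}\mathrm{cost}(R,x)$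 (taken as $0$ if $\mathrm{Dom}(f)=\emptyset$), and $\mathrm{noisyR}_\epsilon(f)$ is the infimum of the worst-case expected costs of all noisy oracle algorithms computing $f$ to error $\epsilon$. A partial Boolean function $f\colon S\to\{0,1\}$, $S\subseteq\{0,1\}^n$, is identified with its graph (so $\mathrm{Dom}(f)=S$ and $f_x=\{f(x)\}$), and $\mathrm{noisyR}(f)=\mathrm{noisyR}_{1/3}(f)$. **Theorem.** 1. There is a universal constant $C>0$ such that for every $n\ge1$ and every (possibly partial) Boolean function $f$ on $n$ bits there is a noisy oracle algorithm $A$ that computes $f$ to error $1/3$, makes only noisy oracle calls with parameter $\gamma=1/\sqrt n$ or $\gamma=1$, and has worst-case expected cost at most $C\cdot\mathrm{noisyR}(f)$. 2. For every $\epsilon\in[0,1/2)$ there is a constant $C>0$, depending only on $\epsilon$, such that for every $n\ge1$, every finite set $\Sigma$ and every relation $f\subseteq\{0,1\}^n\times\Sigma$ for which there are two inputs $x,y\in\mathrm{Dom}(f)$ with disjoint sets of allowed outputs, there is a noisy oracle algorithm $A$ that computes $f$ to error $\epsilon$, makes only noisy oracle calls with parameter $\gamma=1/\sqrt n$ or $\gamma=1$,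 and has worst-case expected cost at most $C\cdot\mathrm{noisyR}_\epsilon(f)$. -/

import Mathlib

noncomputable section

/-- A (finite) noisy oracle decision tree on `n` bits with leaves labelled by `S`. An internal node
is labelled by a position `i` and a parameter `γ ∈ [0, 1]`; its first subtree (the left child) is
entered when the oracle answers `0`, its second subtree (the right child) when it answers `1`. -/
inductive NoisyTree (n : ℕ) (S : Type*) where
  | leaf (a : S) : NoisyTree n S
  | query (i : Fin n) (γ : Set.Icc (0 : ℝ) 1) (left right : NoisyTree n S) : NoisyTree n S

/-- The probability that a noisy oracle to the bit `b`, called with parameter `γ`, outputs `a`: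
the correct bit is returned with probability `(1 + γ) / 2`. -/
def noisyOracleProb (b : Bool) (γ : ℝ) (a : Bool) : ℝ :=
  if a = b then (1 + γ) / 2 else (1 - γ) / 2

namespace NoisyTree

variable {n : ℕ} {S : Type*}

/-- The probability that the leaf reached on input `x` has its label in `T`
(all oracle calls being independent). -/
def prob (x : Fin n → Bool) (T : Set S) : NoisyTree n S → ℝ
  | leaf a => T.indicator 1 a
  | query i γ l r =>
      noisyOracleProb (x i) γ false * l.prob x T + noisyOracleProb (x i) γ true * r.prob x T

/-- The expected cost on input `x`, where a call with parameter `γ` costs `γ ^ 2`. -/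
def cost (x : Fin n → Bool) : NoisyTree n S → ℝ
  | leaf _ => 0
  | query i γ l r =>
      (γ : ℝ) ^ 2 +
        (noisyOracleProb (x i) γ false * l.cost x + noisyOracleProb (x i) γ true * r.cost x)

/-- The set of parameters that occur at the internal nodes. -/
def params : NoisyTree n S → Set ℝ
  | leaf _ => ∅
  | query _ γ l r => insert (γ : ℝ) (l.params ∪ r.params)

end NoisyTree

/-- A noisy oracle randomized algorithm on `n` bits with outputs in `S`: a finitely supported
probability distribution over noisy oracle decision trees. -/
abbrev NoisyAlg (n : ℕ) (S : Type*) := Convexity.StdSimplex ℝ (NoisyTree n S)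

namespace NoisyAlg

variable {n : ℕ} {S : Type*}

/-- The probability that the output on input `x` lies in `T`. -/
def prob (R : NoisyAlg n S) (x : Fin n → Bool) (T : Set S) : ℝ :=
  R.weights.sum fun D w => w * D.prob x T

/-- The expected cost on input `x`. -/
def cost (R : NoisyAlg n S) (x : Fin n → Bool) : ℝ :=
  R.weights.sum fun D w => w * D.cost x

/-- Every oracle call that the algorithm may make has its parameter in `Γ`. -/
def UsesOnly (R : NoisyAlg n S) (Γ : Set ℝ) : Prop :=
  ∀ D ∈ R.weights.support, D.params ⊆ Γ

/-- `R` computes the relation `f` to error `ε`: on every input `x` in the domain of `f` (that is,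
with at least one allowed output), the output is allowed for `x` with probability at least
`1 - ε`. For the graph of a partial function `g` this says `Pr[R(x) = g(x)] ≥ 1 - ε` for all
`x ∈ Dom(g)`. -/
def Computes (R : NoisyAlg n S) (f : SetRel (Fin n → Bool) S) (ε : ℝ) : Prop :=
  ∀ x ∈ f.dom, 1 - ε ≤ R.prob x {a | (x, a) ∈ f}

/-- The expected cost in the worst case over the (finitely many) inputs in the domain of `f`. -/
def worstCost (R : NoisyAlg n S) (f : SetRel (Fin n → Bool) S) : ℝ :=
  ⨆ x : f.dom, R.cost x

end NoisyAlg

/-- The `ε`-error noisy randomized query complexity of a relation: the infimum of the worst-case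
expected costs of the noisy oracle randomized algorithms that compute it to error `ε`. -/
def noisyRError {n : ℕ} {S : Type*} (ε : ℝ) (f : SetRel (Fin n → Bool) S) : ℝ :=
  ⨅ R : {R : NoisyAlg n S // R.Computes f ε}, R.1.worstCost f

/-- A possibly partial Boolean function on `n` bits. -/
abbrev PartialBoolFun (n : ℕ) := (Fin n → Bool) →. Bool

/-- The noisy randomized query complexity (to error `1 / 3`) of a partial Boolean function. -/
def noisyR {n : ℕ} (f : PartialBoolFun n) : ℝ :=
  noisyRError (1 / 3) f.graph

end

noncomputable section

/-! With g = 1/√n, every algorithm can be simulated exactly, using only the parameters g and 1, at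
cost at most 1 + 16 · (its cost) on each input (`NoisyAlg.exists_simulation`). Two devices do this.
Calls with γ ≥ g/2 are synthesized (`simulates_of_half_le`): repeating a call until two consecutive
answers agree nearly doubles the bias and multiplies the cost by about 4. The ratio cost/bias² loses
a factor 1 + O(g²) each time, and the product of these factors over the growing biases stays
bounded. Calls with γ < g/2 are free. For each position j one answer X_j of parameter g is bought in
advance, at total cost n·g² = 1, and weak answers are sampled from X_j so that their joint law is
correct. This works while the posterior mean s_j of the sign of x_j, from a uniform prior, satisfies
|s_j| ≤ g/2; beyond that X_j is bought anew. A weak call raises E[s_j²] by at most 4γ², and a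
purchase happens only when s_j² > g²/4, so the potential 4∑ s_j² pays for it
(`familyRealizes_potential`). The additive 1 is absorbed by a lower bound: by a Hellinger affinity
argument, telling apart two inputs with disjoint allowed outputs costs at least a constant
(`NoisyAlg.Computes.le_worstCost`). -/

/-! ### Single oracle answers. -/

/-- The sign `±1` of a bit. -/
def boolSign (b : Bool) : ℝ := if b then 1 else -1

lemma boolSign_sq (b : Bool) : boolSign b ^ 2 = 1 := by
  cases b <;> simp [boolSign]

lemma boolSign_eq_or (b : Bool) : boolSign b = 1 ∨ boolSign b = -1 := by
  cases b <;> simp [boolSign]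

lemma noisyOracleProb_eq (b : Bool) (γ : ℝ) (a : Bool) :
    noisyOracleProb b γ a = (1 + boolSign a * boolSign b * γ) / 2 := by
  cases a <;> cases b <;> simp [noisyOracleProb, boolSign] <;> ring

lemma noisyOracleProb_nonneg (b : Bool) {γ : ℝ} (h0 : 0 ≤ γ) (h1 : γ ≤ 1) (a : Bool) :
    0 ≤ noisyOracleProb b γ a := by
  unfold noisyOracleProb
  split_ifs <;> linarith

lemma noisyOracleProb_add (b : Bool) (γ : ℝ) :
    noisyOracleProb b γ false + noisyOracleProb b γ true = 1 := by
  cases b <;> simp [noisyOracleProb] <;> ring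

/-! ### Profiles of algorithms and their convexity. -/

/-- The output probabilities and the expected costs, as functions of the input. -/
abbrev NoisyProfile (n : ℕ) (S : Type*) :=
  ((Fin n → Bool) → Set S → ℝ) × ((Fin n → Bool) → ℝ)

namespace NoisyProfile

variable {n : ℕ} {S : Type*}

/-- The profile of a single tree. -/
def ofTree (D : NoisyTree n S) : NoisyProfile n S :=
  (fun x T => D.prob x T, fun x => D.cost x)

/-- The profile of an algorithm that spends `k` on learning the bit `i` with bias `g`, and
continues as `u` if the answer is `0` and as `v` if it is `1`. -/
def branch (i : Fin n) (g k : ℝ) (u v : NoisyProfile n S) : NoisyProfile n S :=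
  (fun x T => noisyOracleProb (x i) g false * u.1 x T + noisyOracleProb (x i) g true * v.1 x T,
   fun x => k + (noisyOracleProb (x i) g false * u.2 x + noisyOracleProb (x i) g true * v.2 x))

/-- The profiles dominated in cost by an algorithm with parameters in `Γ`. -/
def realizable (n : ℕ) (S : Type*) (Γ : Set ℝ) : Set (NoisyProfile n S) :=
  {v | ∃ u ∈ convexHull ℝ (ofTree '' {D : NoisyTree n S | D.params ⊆ Γ}), u.1 = v.1 ∧ u.2 ≤ v.2}

variable {Γ : Set ℝ}

lemma realizable_mono {u v : NoisyProfile n S} (hu : u ∈ realizable n S Γ) (h1 : u.1 = v.1)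
    (h2 : u.2 ≤ v.2) : v ∈ realizable n S Γ := by
  obtain ⟨w, hw, e, l⟩ := hu
  exact ⟨w, hw, e.trans h1, l.trans h2⟩

lemma ofTree_mem_realizable {D : NoisyTree n S} (h : D.params ⊆ Γ) :
    ofTree D ∈ realizable n S Γ :=
  ⟨_, subset_convexHull _ _ ⟨D, h, rfl⟩, rfl, le_rfl⟩

lemma convex_realizable : Convex ℝ (realizable n S Γ) := by
  rintro v ⟨v', hv, e1, l1⟩ w ⟨w', hw, e2, l2⟩ a b ha hb hab
  refine ⟨_, convex_convexHull _ _ hv hw ha hb hab, ?_, ?_⟩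
  · simp [e1, e2]
  · exact add_le_add (smul_le_smul_of_nonneg_left l1 ha) (smul_le_smul_of_nonneg_left l2 hb)

lemma branch_combo_left (i : Fin n) (g k : ℝ) (u u' v : NoisyProfile n S) {a b : ℝ}
    (hab : a + b = 1) :
    branch i g k (a • u + b • u') v = a • branch i g k u v + b • branch i g k u' v := by
  obtain rfl : b = 1 - a := by linarith
  ext x <;> simp [branch] <;> ring

lemma branch_combo_right (i : Fin n) (g k : ℝ) (u v v' : NoisyProfile n S) {a b : ℝ}
    (hab : a + b = 1) :
    branch i g k u (a • v + b • v') = a • branch i g k u v + b • branch i g k u v' := by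
  obtain rfl : b = 1 - a := by linarith
  ext x <;> simp [branch] <;> ring

/-! ### Synthesizing larger biases from smaller ones. -/

/-- A bias `g` on any bit can be obtained at expected cost `k` with parameters in `Γ`. -/
def Simulates (n : ℕ) (S : Type*) (Γ : Set ℝ) (g k : ℝ) : Prop :=
  ∀ (i : Fin n) (u v : NoisyProfile n S), u ∈ realizable n S Γ → v ∈ realizable n S Γ →
    branch i g k u v ∈ realizable n S Γ

/-- `branch` is affine in each continuation separately, so membership in the hull is checked on
trees for one continuation and then extended to the other. -/
lemma simulates_of_mem {γ : ℝ} (hγ : γ ∈ Γ) (h0 : 0 ≤ γ) (h1 : γ ≤ 1) :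
    Simulates n S Γ γ (γ ^ 2) := by
  rintro i u v ⟨u', hu, eu, lu⟩ ⟨v', hv, ev, lv⟩
  refine ⟨branch i γ (γ ^ 2) u' v', ?_, ?_, ?_⟩
  · set H := convexHull ℝ (ofTree '' {D : NoisyTree n S | D.params ⊆ Γ}) with hH
    have hconv : Convex ℝ H := convex_convexHull _ _
    have key : ∀ D : NoisyTree n S, D.params ⊆ Γ →
        H ⊆ {w | branch i γ (γ ^ 2) (ofTree D) w ∈ H} := by
      intro D hD
      refine convexHull_min ?_ ?_
      · rintro _ ⟨E, hE, rfl⟩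
        refine subset_convexHull _ _ ⟨NoisyTree.query i ⟨γ, h0, h1⟩ D E, ?_, rfl⟩
        simp only [NoisyTree.params, Set.mem_ofPred_eq]
        exact Set.insert_subset hγ (Set.union_subset hD hE)
      · intro w hw w' hw' a b ha hb hab
        simp only [Set.mem_ofPred_eq] at hw hw' ⊢
        rw [branch_combo_right _ _ _ _ _ _ hab]
        exact hconv hw hw' ha hb hab
    have key2 : H ⊆ {w | branch i γ (γ ^ 2) w v' ∈ H} := by
      refine convexHull_min ?_ ?_
      · rintro _ ⟨D, hD, rfl⟩
        exact key D hD hv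
      · intro w hw w' hw' a b ha hb hab
        simp only [Set.mem_ofPred_eq] at hw hw' ⊢
        rw [branch_combo_left _ _ _ _ _ _ hab]
        exact hconv hw hw' ha hb hab
    exact key2 hu
  · simp [branch, eu, ev]
  · intro x
    have := noisyOracleProb_nonneg (x i) h0 h1
    exact add_le_add le_rfl (add_le_add (mul_le_mul_of_nonneg_left (lu x) (this _))
      (mul_le_mul_of_nonneg_left (lv x) (this _)))

lemma Simulates.mono {g k k' : ℝ} (h : Simulates n S Γ g k) (hk : k ≤ k') :
    Simulates n S Γ g k' := fun i u v hu hv =>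
  realizable_mono (h i u v hu hv) rfl fun _ => add_le_add hk le_rfl

lemma simulates_zero : Simulates n S Γ 0 0 := by
  intro i u v hu hv
  convert convex_realizable hu hv (a := 1 / 2) (b := 1 / 2) (by norm_num) (by norm_num)
    (by norm_num) using 1
  ext x <;> simp [branch, noisyOracleProb]

/-- Make the call with probability p and flip a fair coin otherwise. The cost is only linear in p,
so this serves to correct an overshoot by a constant factor. -/
lemma Simulates.scale {g k p : ℝ} (h : Simulates n S Γ g k) (h0 : 0 ≤ p) (h1 : p ≤ 1) :
    Simulates n S Γ (p * g) (p * k) := by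
  intro i u v hu hv
  convert convex_realizable (h i u v hu hv) (simulates_zero i u v hu hv) (a := p) (b := 1 - p)
    h0 (by linarith) (by ring) using 1
  ext x <;> simp [branch, noisyOracleProb_eq] <;> ring

/-- Ask twice, accept the answer if both agree, and otherwise fall back on g'. Agreement contributes
the bias ((1+g)/2)² − ((1−g)/2)² = g; disagreement has probability (1−g²)/2 whatever the bit. -/
lemma Simulates.retry {g k g' k' : ℝ} (h : Simulates n S Γ g k) (h' : Simulates n S Γ g' k') :
    Simulates n S Γ (g + (1 - g ^ 2) / 2 * g') (2 * k + (1 - g ^ 2) / 2 * k') := by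
  intro i u v hu hv
  have hX := h' i u v hu hv
  convert h i _ _ (h i _ _ hu hX) (h i _ _ hX hv) using 1
  ext x <;> cases hb : x i <;> simp [branch, noisyOracleProb, hb] <;> ring

/-- As t grows, the bias tends to 2g/(1+g²) and the cost to 4k/(1+g²), so in the limit cost/bias² is
multiplied by just 1+g². Trees are finite, hence the truncation at t rounds, ending in a fair coin.
-/
lemma Simulates.retry_iterate {g k : ℝ} (h : Simulates n S Γ g k) (t : ℕ) :
    Simulates n S Γ (g * ∑ j ∈ Finset.range t, ((1 - g ^ 2) / 2) ^ j)
      (2 * k * ∑ j ∈ Finset.range t, ((1 - g ^ 2) / 2) ^ j) := by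
  induction t with
  | zero => simpa using simulates_zero
  | succ t ih =>
    convert h.retry ih using 1 <;> rw [Finset.sum_range_succ'] <;>
      simp only [pow_succ, ← Finset.sum_mul] <;> ring

/-- Any bias `g ≤ 1 / 4` can be almost doubled with hardly any loss in the ratio of the cost to
the square of the bias. -/
lemma Simulates.double {g k : ℝ} (h : Simulates n S Γ g k) (h0 : 0 < g) (h1 : g ≤ 1 / 4)
    (hk : k ≤ (1 + 2 * g ^ 2) * g ^ 2) :
    ∃ g' k', Simulates n S Γ g' k' ∧ 3 / 2 * g ≤ g' ∧ g' ≤ 2 * g ∧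
      k' ≤ (1 + 2 * g' ^ 2) * g' ^ 2 := by
  have hg2 : 0 < g ^ 2 := by positivity
  have hg2' : g ^ 2 ≤ 1 / 16 := by nlinarith
  set δ := (1 - g ^ 2) / 2 with hδ
  have hδ0 : 0 ≤ δ := by linarith
  have hδ1 : δ < 1 := by linarith
  -- This threshold puts s between 2/(1+g²)² and its limit 2/(1+g²): truncation costs at most one
  -- more factor 1+g².
  obtain ⟨t, ht⟩ := exists_pow_lt_of_lt_one (show 0 < g ^ 2 / (1 + g ^ 2) by positivity) hδ1
  set s := ∑ j ∈ Finset.range t, δ ^ j with hs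
  have hgeom : s * (1 - δ) = 1 - δ ^ t := by
    have := geom_sum_mul δ t
    linarith
  have hpow : 0 ≤ δ ^ t := pow_nonneg hδ0 t
  have hsu : s * (1 + g ^ 2) ≤ 2 := by
    have : 1 - δ = (1 + g ^ 2) / 2 := by rw [hδ]; ring
    rw [this] at hgeom
    linarith
  have hsl : 2 ≤ s * (1 + g ^ 2) ^ 2 := by
    have : 1 - δ = (1 + g ^ 2) / 2 := by rw [hδ]; ring
    rw [this] at hgeom
    rw [lt_div_iff₀ (by positivity)] at ht
    nlinarith
  have hs2 : s ≤ 2 := by nlinarith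
  have hs3 : 3 / 2 ≤ s := by
    have : (1 + g ^ 2) ^ 2 ≤ 4 / 3 := by nlinarith
    have hs0 : 0 ≤ s := Finset.sum_nonneg fun _ _ => pow_nonneg hδ0 _
    nlinarith
  refine ⟨g * s, 2 * k * s, h.retry_iterate t, by nlinarith, by nlinarith, ?_⟩
  have e1 : 2 * k * s ≤ 2 * ((1 + 2 * g ^ 2) * g ^ 2) * s := by
    have : 0 ≤ s := by linarith
    gcongr
  refine e1.trans ?_
  have e2 : (3 / 2) ^ 2 ≤ s ^ 2 := by gcongr
  have e3 : 2 * (1 + 2 * g ^ 2) ≤ (1 + 2 * (g * s) ^ 2) * s := by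
    refine le_of_mul_le_mul_right ?_ (show 0 < (1 + g ^ 2) ^ 2 by positivity)
    -- To first order the left side is 1 + 4g²; since s ≥ 3/2, the right side is at least 1 +
    -- (9/2)g². This gap is what makes the invariant k ≤ (1+2g²)g² survive.
    have e4 : (1 + 2 * g ^ 2) * (1 + g ^ 2) ^ 2 ≤ 1 + 2 * (g * s) ^ 2 := by
      have : (1 + 2 * g ^ 2) * (1 + g ^ 2) ^ 2 ≤ 1 + 2 * (9 / 4) * g ^ 2 := by
        nlinarith [mul_nonneg hg2.le hg2.le, mul_nonneg (mul_nonneg hg2.le hg2.le) hg2.le]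
      nlinarith
    nlinarith [mul_nonneg (sub_nonneg.2 hsl) (show 0 ≤ 1 + 2 * (g * s) ^ 2 by positivity)]
  calc 2 * ((1 + 2 * g ^ 2) * g ^ 2) * s = (2 * (1 + 2 * g ^ 2)) * (g ^ 2 * s) := by ring
    _ ≤ ((1 + 2 * (g * s) ^ 2) * s) * (g ^ 2 * s) := by
      apply mul_le_mul_of_nonneg_right e3; nlinarith
    _ = _ := by ring

/-- Doubling multiplies the bias by a factor in [3/2, 2], so it cannot jump over [γ, 2γ] and cannot
stay below γ forever. -/
lemma Simulates.exists_between {g₀ : ℝ} (h : Simulates n S Γ g₀ (g₀ ^ 2)) (h0 : 0 < g₀) {γ : ℝ}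
    (hγ : γ ≤ 1 / 4) (hg : g₀ ≤ γ) :
    ∃ g k, Simulates n S Γ g k ∧ γ ≤ g ∧ g ≤ 2 * γ ∧ k ≤ (1 + 2 * g ^ 2) * g ^ 2 := by
  by_contra! hno
  have key : ∀ m : ℕ, ∃ g k, Simulates n S Γ g k ∧ (3 / 2) ^ m * g₀ ≤ g ∧ g ≤ γ ∧
      k ≤ (1 + 2 * g ^ 2) * g ^ 2 := by
    intro m
    induction m with
    | zero => exact ⟨g₀, _, h, by simp, hg, by nlinarith [sq_nonneg (g₀ ^ 2)]⟩
    | succ m ih =>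
      obtain ⟨g, k, hs, hl, hu, hk⟩ := ih
      have hg0 : 0 < g := lt_of_lt_of_le (by positivity) hl
      obtain ⟨g', k', hs', hl', hu', hk'⟩ := hs.double hg0 (by linarith) hk
      refine ⟨g', k', hs', ?_, ?_, hk'⟩
      · rw [pow_succ]; linarith
      · by_contra! hlt
        exact absurd hk' (not_le.2 (hno g' k' hs' hlt.le (by linarith)))
  obtain ⟨m, hm⟩ := pow_unbounded_of_one_lt (γ / g₀) (show (1 : ℝ) < 3 / 2 by norm_num)
  obtain ⟨g, k, -, hl, hu, -⟩ := key m
  rw [div_lt_iff₀ h0] at hm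
  linarith

/-- Any bias `γ ≥ g₀ / 2` can be obtained at cost `O(γ ^ 2)` with parameters `g₀` and `1`. -/
lemma simulates_of_half_le {g₀ γ : ℝ} (hΓ : g₀ ∈ Γ) (h1Γ : 1 ∈ Γ) (h0 : 0 < g₀) (h1 : g₀ ≤ 1)
    (hγ : g₀ / 2 ≤ γ) (hγ1 : γ ≤ 1) : Simulates n S Γ γ (16 * γ ^ 2) := by
  have hγ0 : 0 < γ := by linarith
  rcases le_total γ (1 / 4) with hq | hq
  · obtain ⟨g, k, hs, hl, hu, hk⟩ : ∃ g k, Simulates n S Γ g k ∧ γ ≤ g ∧ g ≤ 2 * γ ∧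
        k ≤ (1 + 2 * g ^ 2) * g ^ 2 := by
      have hs₀ := simulates_of_mem (n := n) (S := S) hΓ h0.le h1
      rcases le_total g₀ γ with hle | hle
      · exact hs₀.exists_between h0 hq hle
      -- Here g₀/2 ≤ γ ≤ g₀, so g₀ itself overshoots by at most a factor 2.
      · exact ⟨g₀, _, hs₀, hle, by linarith, by nlinarith [sq_nonneg (g₀ ^ 2)]⟩
    have hg0 : 0 < g := by linarith
    have := hs.scale (p := γ / g) (by positivity) ((div_le_one hg0).2 hl)
    rw [div_mul_cancel₀ _ hg0.ne'] at this
    refine this.mono ?_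
    have hg4 : g ^ 2 ≤ 1 / 4 := by nlinarith
    have hk2 : k ≤ 2 * g ^ 2 := by nlinarith
    calc γ / g * k ≤ γ / g * (2 * g ^ 2) := by gcongr
      _ = 2 * γ * g := by field_simp
      _ ≤ 16 * γ ^ 2 := by nlinarith
  -- A perfect call made with probability γ costs γ ≤ 4γ² once γ ≥ 1/4.
  · have := (simulates_of_mem (n := n) (S := S) h1Γ zero_le_one le_rfl).scale hγ0.le hγ1
    rw [mul_one] at this
    exact this.mono (by nlinarith)

/-! ### Families of profiles indexed by auxiliary bits. -/

/-- Resampling the coordinate `i` from `β` replaces the weight at `i` by `β`. -/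
lemma sum_prod_mul_resample (w : Fin n → Bool → ℝ) (β : Bool → ℝ) (i : Fin n)
    (G : (Fin n → Bool) → ℝ) (hw : ∑ x, w i x = 1) :
    ∑ X : Fin n → Bool, (∏ j, w j (X j)) * ∑ y, β y * G (Function.update X i y) =
      ∑ X : Fin n → Bool, (∏ j, Function.update w i β j (X j)) * G X := by
  have key : ∀ (v : Fin n → Bool → ℝ) (H : (Fin n → Bool) → ℝ),
      ∑ X : Fin n → Bool, (∏ j, v j (X j)) * H X =
        ∑ Z : {j // j ≠ i} → Bool, (∏ j : {j // j ≠ i}, v j.1 (Z j)) *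
          ∑ x, v i x * H ((Equiv.funSplitAt i Bool).symm (x, Z)) := by
    intro v H
    rw [← (Equiv.funSplitAt i Bool).symm.sum_comp, Fintype.sum_prod_type, Finset.sum_comm]
    refine Finset.sum_congr rfl fun Z _ => ?_
    rw [Finset.mul_sum]
    refine Finset.sum_congr rfl fun x _ => ?_
    rw [Fintype.prod_eq_mul_prod_subtype_ne _ i]
    have h1 : (Equiv.funSplitAt i Bool).symm (x, Z) i = x := by simp
    have h2 : ∀ j : {j // j ≠ i}, (Equiv.funSplitAt i Bool).symm (x, Z) j.1 = Z j := by
      intro j; simp [j.2]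
    simp only [h1, h2]
    ring
  rw [key, key]
  refine Finset.sum_congr rfl fun Z _ => ?_
  have h1 : ∀ x y, Function.update ((Equiv.funSplitAt i Bool).symm (x, Z)) i y =
      (Equiv.funSplitAt i Bool).symm (y, Z) := by
    intro x y
    ext j
    by_cases hj : j = i
    · subst hj; simp
    · simp [hj]
  simp only [h1]
  rw [← Finset.sum_mul, hw, one_mul]
  congr 1
  · refine Finset.prod_congr rfl fun j _ => ?_
    rw [Function.update_of_ne j.2]
  · simp

lemma sum_prod_eq_one (w : Fin n → Bool → ℝ) (hw : ∀ j, ∑ x, w j x = 1) :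
    ∑ X : Fin n → Bool, ∏ j, w j (X j) = 1 := by
  have := Finset.prod_univ_sum (fun _ : Fin n => (Finset.univ : Finset Bool)) w
  rw [Fintype.piFinset_univ] at this
  rw [← this]
  exact Finset.prod_eq_one fun j _ => hw j

/-- There is a family of realizable profiles, indexed by auxiliary bits `X`, whose average is
dominated by `v` when, on the input `b`, each `X j` is drawn independently from `w j (b j)`. -/
def FamilyRealizes (Γ : Set ℝ) (w : Fin n → Bool → Bool → ℝ) (v : NoisyProfile n S) : Prop :=
  ∃ F : (Fin n → Bool) → NoisyProfile n S, (∀ X, F X ∈ realizable n S Γ) ∧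
    ∀ b, (∀ T, ∑ X, (∏ j, w j (b j) (X j)) * (F X).1 b T = v.1 b T) ∧
      ∑ X, (∏ j, w j (b j) (X j)) * (F X).2 b ≤ v.2 b

lemma FamilyRealizes.mono {w : Fin n → Bool → Bool → ℝ} {u v : NoisyProfile n S}
    (h : FamilyRealizes Γ w u) (h1 : u.1 = v.1) (h2 : u.2 ≤ v.2) : FamilyRealizes Γ w v := by
  obtain ⟨F, hF, hb⟩ := h
  exact ⟨F, hF, fun b => ⟨fun T => h1 ▸ (hb b).1 T, (hb b).2.trans (h2 b)⟩⟩

/-- Querying the bit `i` afresh discards the old auxiliary bit. -/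
lemma FamilyRealizes.resample {w : Fin n → Bool → Bool → ℝ} {v : NoisyProfile n S} {g k : ℝ}
    {i : Fin n} (hg : Simulates n S Γ g k) (hw : ∀ j b, ∑ x, w j b x = 1)
    (h : FamilyRealizes Γ (Function.update w i fun b x => noisyOracleProb b g x) v) :
    FamilyRealizes Γ w (v.1, fun b => k + v.2 b) := by
  obtain ⟨F, hF, hb⟩ := h
  have hupd : ∀ b : Fin n → Bool,
      (fun j => Function.update w i (fun b x => noisyOracleProb b g x) j (b j)) =
        Function.update (fun j => w j (b j)) i (noisyOracleProb (b i) g) := by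
    intro b
    ext j : 1
    by_cases hj : j = i
    · subst hj; simp
    · simp [hj]
  refine ⟨fun X => branch i g k (F (Function.update X i false)) (F (Function.update X i true)),
    fun X => hg i _ _ (hF _) (hF _), fun b => ⟨fun T => ?_, ?_⟩⟩
  · rw [← (hb b).1 T]
    have := sum_prod_mul_resample (fun j => w j (b j)) (noisyOracleProb (b i) g) i
      (fun X => (F X).1 b T) (hw i _)
    rw [← hupd b] at this
    simpa [branch, add_comm] using this
  · have := sum_prod_mul_resample (fun j => w j (b j)) (noisyOracleProb (b i) g) i
      (fun X => (F X).2 b) (hw i _)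
    rw [← hupd b] at this
    have h1 := sum_prod_eq_one (fun j => w j (b j)) fun j => hw j _
    have h2 : ∑ X, (∏ j, w j (b j) (X j)) *
        (branch i g k (F (Function.update X i false)) (F (Function.update X i true))).2 b =
        k + ∑ X : Fin n → Bool, (∏ j, w j (b j) (X j)) *
          ∑ y, noisyOracleProb (b i) g y * (F (Function.update X i y)).2 b := by
      simp only [branch, mul_add, Finset.sum_add_distrib, ← Finset.sum_mul, h1, one_mul,
        Fintype.sum_bool]
      ring
    rw [h2, this]
    exact add_le_add le_rfl (hb b).2

/-- Once all auxiliary bits have been queried, a family can be realized. -/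
lemma FamilyRealizes.realizable {v : NoisyProfile n S} {g k : ℝ} (hg : Simulates n S Γ g k)
    (h : FamilyRealizes Γ (fun _ b x => noisyOracleProb b g x) v) :
    ((v.1, fun b => n * k + v.2 b) : NoisyProfile n S) ∈ realizable n S Γ := by
  -- J holds the positions still to be queried, whose auxiliary bits carry the dummy value `true`.
  -- For J = univ the weights no longer depend on the input, and a single member of the family
  -- remains.
  have key : ∀ J : Finset (Fin n), FamilyRealizes Γ
      (fun j b x => if j ∈ J then (if x then 1 else 0) else noisyOracleProb b g x)
      (v.1, fun b => J.card * k + v.2 b) := by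
    intro J
    induction J using Finset.induction_on with
    | empty => simpa using h
    | insert i J hi ih =>
      refine FamilyRealizes.mono (FamilyRealizes.resample (i := i) hg ?_ ?_
        (v := (v.1, fun b => J.card * k + v.2 b))) rfl ?_
      · intro j b
        have := noisyOracleProb_add b g
        split_ifs <;> simp [← this, add_comm]
      · convert ih using 1
        ext j b x
        by_cases hj : j = i
        · subst hj; simp [hi]
        · simp [hj]
      · intro b
        simp only [Finset.card_insert_of_notMem hi]
        push_cast
        exact le_of_eq (by ring)
  obtain ⟨F, hF, hb⟩ := key Finset.univ
  have hone : ∀ G : (Fin n → Bool) → ℝ,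
      ∑ X : Fin n → Bool, (∏ j, if X j then (1 : ℝ) else 0) * G X = G fun _ => true := by
    intro G
    rw [Finset.sum_eq_single fun _ => true]
    · simp
    · intro X _ hX
      obtain ⟨j, hj⟩ := Function.ne_iff.1 hX
      rw [Finset.prod_eq_zero (Finset.mem_univ j) (by simpa using hj), zero_mul]
    · simp
  simp only [Finset.mem_univ, if_true, hone, Finset.card_univ, Fintype.card_fin] at hb
  exact realizable_mono (hF fun _ => true) (by ext b T; exact (hb b).1 T) fun b => (hb b).2

end NoisyProfile
-- Bayesian updating of one auxiliary bit.
/-- The posterior mean of a uniform sign with prior mean `s` after the noisy answer `a`. -/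
def updateBias (s γ : ℝ) (a : Bool) : ℝ := (s + boolSign a * γ) / (1 + s * (boolSign a * γ))

/-- The conditional distribution of an auxiliary noisy answer `x` of parameter `g` to the bit `b`,
given a history that has been simulated from `x` and has posterior mean `s`. -/
def auxWeight (g s : ℝ) (b x : Bool) : ℝ :=
  (1 + boolSign b * boolSign x * g) * (1 + boolSign x * s / g) / (2 * (1 + boolSign b * s))

/-- The probability of the next answer `a`, with parameter `γ`, in a simulation from `x`. -/
def auxAnswer (g s γ : ℝ) (x a : Bool) : ℝ :=
  (1 + s * (boolSign a * γ) + boolSign x * (s + boolSign a * γ) / g) /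
    (2 * (1 + boolSign x * s / g))

lemma boolSign_mul_abs_le {s t : ℝ} (h : |s| ≤ t) (b : Bool) :
    -t ≤ boolSign b * s ∧ boolSign b * s ≤ t := by
  obtain ⟨h1, h2⟩ := abs_le.1 h
  rcases boolSign_eq_or b with hb | hb <;> rw [hb] <;> constructor <;> linarith

lemma boolSign_mul_abs_lt {s t : ℝ} (h : |s| < t) (b : Bool) :
    -t < boolSign b * s ∧ boolSign b * s < t := by
  obtain ⟨h1, h2⟩ := abs_lt.1 h
  rcases boolSign_eq_or b with hb | hb <;> rw [hb] <;> constructor <;> linarith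

lemma auxWeight_zero (g : ℝ) (b x : Bool) : auxWeight g 0 b x = noisyOracleProb b g x := by
  rw [noisyOracleProb_eq, auxWeight]
  simp only [mul_zero, zero_div, add_zero, mul_one]
  ring

lemma sum_auxWeight {g s : ℝ} (hg : g ≠ 0) (hs : |s| < 1) (b : Bool) :
    ∑ x, auxWeight g s b x = 1 := by
  have h1 : 1 + boolSign b * s ≠ 0 := by
    have := (boolSign_mul_abs_lt hs b).1
    linarith
  rw [Fintype.sum_bool]
  simp only [auxWeight]
  rw [← add_div, div_eq_one_iff_eq (by simpa using h1)]
  cases b <;> simp [boolSign] <;> field_simp <;> ring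

section

variable {g s γ : ℝ}

lemma one_add_mul_bias_pos (hs : |s| ≤ 1 / 2) (h0 : 0 ≤ γ) (h1 : γ ≤ 1 / 2) (a : Bool) :
    3 / 4 ≤ 1 + s * (boolSign a * γ) := by
  have := (boolSign_mul_abs_le hs a).1
  nlinarith

lemma abs_add_bias_lt (hg : 0 < g) (hg1 : g ≤ 1) (hs : |s| ≤ g / 2) (h0 : 0 ≤ γ) (h1 : γ < g / 2)
    (a : Bool) : |s + boolSign a * γ| < g * (1 + s * (boolSign a * γ)) := by
  have hs' := abs_le.1 hs
  rw [abs_lt]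
  rcases boolSign_eq_or a with ha | ha <;> rw [ha]
  · constructor
    · nlinarith [mul_nonneg h0 hg.le, mul_nonneg (sub_nonneg.2 hs'.1) h0]
    · rcases le_total 0 s with h | h
      · nlinarith [mul_nonneg (mul_nonneg hg.le h) h0]
      · nlinarith [mul_nonneg h0 hg.le, mul_nonneg (sub_nonneg.2 hs'.1) h0]
  · constructor
    · rcases le_total 0 s with h | h
      · nlinarith [mul_nonneg h0 hg.le, mul_nonneg (sub_nonneg.2 hs'.2) h0]
      · nlinarith [mul_nonneg (mul_nonneg hg.le (neg_nonneg.2 h)) h0]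
    · nlinarith [mul_nonneg h0 hg.le, mul_nonneg (sub_nonneg.2 hs'.2) h0]

/-- A history sampled from a bit of parameter g cannot have a posterior mean beyond g in absolute
value. Strictness matters when g = 1: `auxWeight` is normalized only for means of modulus below 1.
-/
lemma abs_updateBias_lt (hg : 0 < g) (hg1 : g ≤ 1) (hs : |s| ≤ g / 2) (h0 : 0 ≤ γ)
    (h1 : γ < g / 2) (a : Bool) : |updateBias s γ a| < g := by
  have hp := one_add_mul_bias_pos (s := s) (by linarith) h0 (by linarith) a
  rw [updateBias, abs_div, abs_of_pos (by linarith : 0 < 1 + s * (boolSign a * γ)),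
    div_lt_iff₀ (by linarith)]
  exact abs_add_bias_lt hg hg1 hs h0 h1 a

lemma one_add_sign_div_pos (hg : 0 < g) (hs : |s| ≤ g / 2) (x : Bool) :
    0 < 1 + boolSign x * s / g := by
  have := (boolSign_mul_abs_le hs x).1
  have h2 : -(1 / 2) ≤ boolSign x * s / g := by
    rw [le_div_iff₀ hg]; linarith
  linarith

lemma auxAnswer_nonneg (hg : 0 < g) (hg1 : g ≤ 1) (hs : |s| ≤ g / 2) (h0 : 0 ≤ γ)
    (h1 : γ < g / 2) (x a : Bool) : 0 ≤ auxAnswer g s γ x a := by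
  refine div_nonneg ?_ (by linarith [one_add_sign_div_pos hg hs x])
  have := (boolSign_mul_abs_lt (abs_add_bias_lt hg hg1 hs h0 h1 a) x).1
  have h2 : -(1 + s * (boolSign a * γ)) ≤ boolSign x * (s + boolSign a * γ) / g := by
    rw [le_div_iff₀ hg]; linarith
  linarith

lemma auxAnswer_add (hg : 0 < g) (hs : |s| ≤ g / 2) (x : Bool) :
    auxAnswer g s γ x false + auxAnswer g s γ x true = 1 := by
  have := one_add_sign_div_pos hg hs x
  rw [auxAnswer, auxAnswer, ← add_div, div_eq_one_iff_eq (by linarith)]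
  cases x <;> simp [boolSign] <;> ring

/-- Bayes' rule for the Markov chain bit – X – history H. Writing signs for bits, E[X | H] = s/g, so
P(H | X) is proportional to 1 + X·s/g. This yields `auxWeight`, and the quotient of these
likelihoods after and before the answer yields `auxAnswer`. -/
lemma auxWeight_mul_auxAnswer (hg : 0 < g) (hg1 : g ≤ 1) (hs : |s| ≤ g / 2) (h0 : 0 ≤ γ)
    (h1 : γ < g / 2) (b x a : Bool) :
    auxWeight g s b x * auxAnswer g s γ x a =
      noisyOracleProb b γ a * auxWeight g (updateBias s γ a) b x := by
  have e1 := one_add_sign_div_pos hg hs x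
  have e2 := one_add_mul_bias_pos (s := s) (by linarith) h0 (by linarith : γ ≤ 1 / 2) a
  have e3 := (boolSign_mul_abs_le (s := s) (t := 1 / 2) (by linarith) b).1
  have e4 : 0 < 1 + boolSign a * boolSign b * γ := by
    rcases boolSign_eq_or a with ha | ha <;> rcases boolSign_eq_or b with hb | hb <;>
      rw [ha, hb] <;> linarith
  have hb2 := boolSign_sq b
  have e7 : 1 + s * boolSign a * γ ≠ 0 := by rw [mul_assoc]; linarith
  have e5 : 1 + boolSign b * updateBias s γ a =
      (1 + boolSign b * s) * (1 + boolSign a * boolSign b * γ) / (1 + s * (boolSign a * γ)) := by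
    rw [updateBias, eq_div_iff (by linarith)]
    field_simp
    linear_combination (-(s * γ * boolSign a)) * hb2
  have e6 : 1 + boolSign x * updateBias s γ a / g =
      (1 + s * (boolSign a * γ) + boolSign x * (s + boolSign a * γ) / g) /
        (1 + s * (boolSign a * γ)) := by
    rw [updateBias]
    field_simp
  rw [noisyOracleProb_eq, auxWeight, auxWeight, auxAnswer, e5, e6]
  have e3' : 0 < 1 + boolSign b * s := by linarith
  have e2' : 0 < 1 + s * (boolSign a * γ) := by linarith
  generalize 1 + boolSign x * s / g = t at *
  generalize 1 + boolSign b * s = t2 at *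
  generalize 1 + s * (boolSign a * γ) + boolSign x * (s + boolSign a * γ) / g = t3 at *
  generalize 1 + s * (boolSign a * γ) = t4 at *
  generalize 1 + boolSign a * boolSign b * γ = t5 at *
  field_simp

/-- The squared posterior mean grows by `O(γ ^ 2)` in expectation. -/
lemma expect_updateBias_sq_le (hs : |s| ≤ 1 / 2) (h0 : 0 ≤ γ) (h1 : γ ≤ 1 / 2) (b : Bool) :
    noisyOracleProb b γ false * updateBias s γ false ^ 2 +
      noisyOracleProb b γ true * updateBias s γ true ^ 2 ≤ s ^ 2 + 4 * γ ^ 2 := by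
  have hp := one_add_mul_bias_pos hs h0 h1 true
  have hm := one_add_mul_bias_pos hs h0 h1 false
  simp only [boolSign, if_true, Bool.false_eq_true, if_false, one_mul, neg_one_mul,
    mul_neg, ← sub_eq_add_neg] at hp hm
  have hs' := abs_le.1 hs
  have hs2 : s ^ 2 ≤ 1 / 4 := by nlinarith
  -- The updated means are s + γd and s − γe. In the expected square the term γ·s(d−e) of first
  -- order is nonpositive; the rest is at most (4/3 + 16/9)γ² ≤ 4γ².
  obtain ⟨d, hd⟩ : ∃ d, d = (1 - s ^ 2) / (1 + s * γ) := ⟨_, rfl⟩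
  obtain ⟨e, he⟩ : ∃ e, e = (1 - s ^ 2) / (1 - s * γ) := ⟨_, rfl⟩
  have hd0 : 0 ≤ d := hd ▸ div_nonneg (by linarith) (by linarith)
  have he0 : 0 ≤ e := he ▸ div_nonneg (by linarith) (by linarith)
  have hd1 : d ≤ 4 / 3 := by
    rw [hd, div_le_iff₀ (by linarith)]; nlinarith
  have he1 : e ≤ 4 / 3 := by
    rw [he, div_le_iff₀ (by linarith)]; nlinarith
  have hde : s * (d - e) ≤ 0 := by
    have : s * (d - e) = -(2 * s ^ 2 * γ * (1 - s ^ 2) / ((1 + s * γ) * (1 - s * γ))) := by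
      rw [hd, he]
      have : (1 + s * γ) ≠ 0 := by linarith
      have : (1 - s * γ) ≠ 0 := by linarith
      field_simp
      ring
    rw [this, neg_nonpos]
    refine div_nonneg ?_ (mul_nonneg (by linarith) (by linarith))
    exact mul_nonneg (by positivity) (by linarith)
  have ut : updateBias s γ true = s + γ * d := by
    simp only [updateBias, boolSign, if_true, one_mul, hd]
    have : (1 + s * γ) ≠ 0 := by linarith
    field_simp
    ring
  have uf : updateBias s γ false = s - γ * e := by
    simp only [updateBias, boolSign, Bool.false_eq_true, if_false, neg_one_mul, he, mul_neg,
      ← sub_eq_add_neg]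
    have : (1 - s * γ) ≠ 0 := by linarith
    field_simp
    ring
  have hβ := boolSign_mul_abs_le hs b
  have e1 : boolSign b * s * (d + e) ≤ 4 / 3 := by nlinarith
  have e2 : d ^ 2 ≤ 16 / 9 := by nlinarith
  have e3 : e ^ 2 ≤ 16 / 9 := by nlinarith
  have pf := noisyOracleProb_nonneg b h0 (by linarith) false
  have pt := noisyOracleProb_nonneg b h0 (by linarith) true
  have hsum := noisyOracleProb_add b γ
  have e4 : noisyOracleProb b γ false * e ^ 2 + noisyOracleProb b γ true * d ^ 2 ≤ 16 / 9 := by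
    nlinarith
  have e5 : noisyOracleProb b γ false * (s - γ * e) ^ 2 +
      noisyOracleProb b γ true * (s + γ * d) ^ 2 =
      s ^ 2 + γ * (s * (d - e)) + γ ^ 2 * (boolSign b * s * (d + e)) + γ ^ 2 *
        (noisyOracleProb b γ false * e ^ 2 + noisyOracleProb b γ true * d ^ 2) := by
    simp only [noisyOracleProb_eq]
    simp only [boolSign, if_true, Bool.false_eq_true, if_false]
    ring
  rw [ut, uf, e5]
  have := mul_nonpos_of_nonneg_of_nonpos h0 hde
  have := mul_le_mul_of_nonneg_left e1 (sq_nonneg γ)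
  have := mul_le_mul_of_nonneg_left e4 (sq_nonneg γ)
  linarith [sq_nonneg γ]

end

/-! ### Simulating a whole tree. -/

namespace NoisyProfile

variable {n : ℕ} {S : Type*} {Γ : Set ℝ}

lemma prod_mul_eq_prod_update {w : Fin n → Bool → ℝ} {i : Fin n} {q p : ℝ} {w' : Bool → ℝ}
    {X : Fin n → Bool} (h : w i (X i) * q = p * w' (X i)) :
    (∏ j, w j (X j)) * q = p * ∏ j, Function.update w i w' j (X j) := by
  rw [Fintype.prod_eq_mul_prod_subtype_ne _ i, Fintype.prod_eq_mul_prod_subtype_ne _ i]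
  have : ∀ j : {j // j ≠ i}, Function.update w i w' j.1 = w j.1 := fun j => by
    rw [Function.update_of_ne j.2]
  simp only [this, Function.update_self]
  linear_combination (∏ j : {j // j ≠ i}, w j.1 (X j.1)) * h

/-- An oracle answer can be simulated from the auxiliary bit at no cost. -/
lemma FamilyRealizes.simulate {w : Fin n → Bool → Bool → ℝ} {i : Fin n}
    {w' : Bool → Bool → Bool → ℝ} {q : Bool → Bool → ℝ} {γ : ℝ} {u v : NoisyProfile n S}
    (hp : ∀ b a, 0 ≤ noisyOracleProb b γ a) (hq : ∀ x a, 0 ≤ q x a)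
    (hq1 : ∀ x, q x false + q x true = 1)
    (hw : ∀ b x a, w i b x * q x a = noisyOracleProb b γ a * w' a b x)
    (hu : FamilyRealizes Γ (Function.update w i (w' false)) u)
    (hv : FamilyRealizes Γ (Function.update w i (w' true)) v) :
    FamilyRealizes Γ w (branch i γ 0 u v) := by
  obtain ⟨F, hF, hFb⟩ := hu
  obtain ⟨G, hG, hGb⟩ := hv
  have hupd : ∀ (a : Bool) (b : Fin n → Bool),
      (fun j => Function.update w i (w' a) j (b j)) =
        Function.update (fun j => w j (b j)) i (w' a (b i)) := by
    intro a b
    ext j : 1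
    by_cases hj : j = i
    · subst hj; simp
    · simp [hj]
  have hprod : ∀ (a : Bool) (b X : Fin n → Bool), (∏ j, w j (b j) (X j)) * q (X i) a =
      noisyOracleProb (b i) γ a * ∏ j, Function.update w i (w' a) j (b j) (X j) := by
    intro a b X
    have := prod_mul_eq_prod_update (w := fun j => w j (b j)) (hw (b i) (X i) a)
    rwa [← hupd a b] at this
  have hsum : ∀ (b : Fin n → Bool) (f h : (Fin n → Bool) → ℝ),
      ∑ X, (∏ j, w j (b j) (X j)) * (q (X i) false * f X + q (X i) true * h X) =
        noisyOracleProb (b i) γ false *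
          ∑ X, (∏ j, Function.update w i (w' false) j (b j) (X j)) * f X +
        noisyOracleProb (b i) γ true *
          ∑ X, (∏ j, Function.update w i (w' true) j (b j) (X j)) * h X := by
    intro b f h
    rw [Finset.mul_sum, Finset.mul_sum, ← Finset.sum_add_distrib]
    refine Finset.sum_congr rfl fun X _ => ?_
    linear_combination f X * hprod false b X + h X * hprod true b X
  refine ⟨fun X => q (X i) false • F X + q (X i) true • G X, fun X => ?_,
    fun b => ⟨fun T => ?_, ?_⟩⟩
  · exact convex_realizable (hF X) (hG X) (hq _ _) (hq _ _) (hq1 _)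
  · have := hsum b (fun X => (F X).1 b T) (fun X => (G X).1 b T)
    rw [(hFb b).1 T, (hGb b).1 T] at this
    exact this
  · have := hsum b (fun X => (F X).2 b) (fun X => (G X).2 b)
    refine this.le.trans ?_
    simp only [branch, zero_add]
    exact add_le_add (mul_le_mul_of_nonneg_left (hFb b).2 (hp _ _))
      (mul_le_mul_of_nonneg_left (hGb b).2 (hp _ _))

/-- A fresh oracle answer does not interfere with the auxiliary bits. -/
lemma FamilyRealizes.branch {w : Fin n → Bool → Bool → ℝ} {i : Fin n} {g k : ℝ}
    {u v : NoisyProfile n S} (hg : Simulates n S Γ g k) (hp : ∀ b a, 0 ≤ noisyOracleProb b g a)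
    (hw : ∀ j b, ∑ x, w j b x = 1) (hu : FamilyRealizes Γ w u) (hv : FamilyRealizes Γ w v) :
    FamilyRealizes Γ w (NoisyProfile.branch i g k u v) := by
  obtain ⟨F, hF, hFb⟩ := hu
  obtain ⟨G, hG, hGb⟩ := hv
  have hsum : ∀ (b : Fin n → Bool) (f h : (Fin n → Bool) → ℝ),
      ∑ X, (∏ j, w j (b j) (X j)) *
        (noisyOracleProb (b i) g false * f X + noisyOracleProb (b i) g true * h X) =
      noisyOracleProb (b i) g false * ∑ X, (∏ j, w j (b j) (X j)) * f X +
        noisyOracleProb (b i) g true * ∑ X, (∏ j, w j (b j) (X j)) * h X := by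
    intro b f h
    rw [Finset.mul_sum, Finset.mul_sum, ← Finset.sum_add_distrib]
    exact Finset.sum_congr rfl fun X _ => by ring
  refine ⟨fun X => NoisyProfile.branch i g k (F X) (G X), fun X => hg i _ _ (hF X) (hG X),
    fun b => ⟨fun T => ?_, ?_⟩⟩
  · have := hsum b (fun X => (F X).1 b T) (fun X => (G X).1 b T)
    rw [(hFb b).1 T, (hGb b).1 T] at this
    exact this
  · have := hsum b (fun X => (F X).2 b) (fun X => (G X).2 b)
    simp only [NoisyProfile.branch, mul_add _ k, Finset.sum_add_distrib, ← Finset.sum_mul]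
    rw [this, sum_prod_eq_one (fun j => w j (b j)) fun j => hw j _, one_mul]
    exact add_le_add le_rfl (add_le_add (mul_le_mul_of_nonneg_left (hFb b).2 (hp _ _))
      (mul_le_mul_of_nonneg_left (hGb b).2 (hp _ _)))

/-- The profile that a simulation of `D` with posterior means `s` has to match. -/
def potential (D : NoisyTree n S) (s : Fin n → ℝ) : NoisyProfile n S :=
  (fun b T => D.prob b T, fun b => 16 * D.cost b + 4 * ∑ j, s j ^ 2)

lemma sum_update_sq (s : Fin n → ℝ) (i : Fin n) (t : ℝ) :
    ∑ j, Function.update s i t j ^ 2 = ∑ j, s j ^ 2 - s i ^ 2 + t ^ 2 := by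
  rw [Fintype.sum_eq_add_sum_subtype_ne _ i,
    Fintype.sum_eq_add_sum_subtype_ne (fun j => s j ^ 2) i]
  have : ∀ j : {j // j ≠ i}, Function.update s i t j.1 = s j.1 := fun j => by
    rw [Function.update_of_ne j.2]
  simp only [this, Function.update_self]
  ring

lemma auxWeight_update (g : ℝ) (s : Fin n → ℝ) (i : Fin n) (t : ℝ) :
    (fun j => auxWeight g (Function.update s i t j)) =
      Function.update (fun j => auxWeight g (s j)) i (auxWeight g t) := by
  ext j : 1
  by_cases hj : j = i
  · subst hj; simp
  · simp [hj]

/-- A posterior mean that has left the admissible range is reset by a query with parameter `g`,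
which the potential pays for. -/
lemma familyRealizes_of_reset {g : ℝ} (hΓ : g ∈ Γ) (hg : 0 < g) (hg1 : g ≤ 1)
    {D : NoisyTree n S}
    (ih : ∀ s : Fin n → ℝ, (∀ j, |s j| ≤ g / 2) →
      FamilyRealizes Γ (fun j => auxWeight g (s j)) (potential D s))
    {s : Fin n → ℝ} (hs : ∀ j, |s j| ≤ g / 2) (i : Fin n) {t : ℝ} (ht : |t| < g) :
    FamilyRealizes Γ (Function.update (fun j => auxWeight g (s j)) i (auxWeight g t))
      (potential D (Function.update s i t)) := by
  have hupd : ∀ r, |r| ≤ g / 2 → ∀ j, |Function.update s i r j| ≤ g / 2 := by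
    intro r hr j
    by_cases hj : j = i
    · subst hj; simpa using hr
    · simpa [hj] using hs j
  rw [← auxWeight_update]
  rcases le_or_gt |t| (g / 2) with h | h
  · exact ih _ (hupd t h)
  · have h0 := ih _ (hupd 0 (by simpa using (half_pos hg).le))
    refine FamilyRealizes.mono (FamilyRealizes.resample (i := i) (v := potential D
      (Function.update s i 0)) (simulates_of_mem hΓ hg.le hg1) ?_ ?_) rfl ?_
    · intro j b
      refine sum_auxWeight hg.ne' ?_ b
      by_cases hj : j = i
      · subst hj; simpa using ht.trans_le hg1
      · simpa [hj] using (hs j).trans_lt (by linarith)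
    · rw [auxWeight_update] at h0 ⊢
      rw [Function.update_idem]
      convert h0 using 2
      ext b x
      exact (auxWeight_zero g b x).symm
    · intro b
      simp only [potential, sum_update_sq]
      -- Resetting the mean from t to 0 frees the potential 4t² ≥ g², the price of the new auxiliary
      -- bit.
      have : (g / 2) ^ 2 ≤ t ^ 2 := by
        rw [← sq_abs t]
        gcongr
      linarith

/-- Every tree can be simulated with the parameters `g` and `1`. -/
lemma familyRealizes_potential {g : ℝ} (hΓ : g ∈ Γ) (h1Γ : 1 ∈ Γ) (hg : 0 < g) (hg1 : g ≤ 1)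
    (D : NoisyTree n S) : ∀ s : Fin n → ℝ, (∀ j, |s j| ≤ g / 2) →
      FamilyRealizes Γ (fun j => auxWeight g (s j)) (potential D s) := by
  have hsum : ∀ s : Fin n → ℝ, (∀ j, |s j| ≤ g / 2) → ∀ j b, ∑ x, auxWeight g (s j) b x = 1 :=
    fun s hs j b => sum_auxWeight hg.ne' ((hs j).trans_lt (by linarith)) b
  induction D with
  | leaf a =>
    intro s hs
    refine ⟨fun _ => ofTree (NoisyTree.leaf a), fun _ => ofTree_mem_realizable (by
      simp [NoisyTree.params]), fun b => ⟨fun T => ?_, ?_⟩⟩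
    · rw [← Finset.sum_mul, sum_prod_eq_one _ fun j => hsum s hs j (b j), one_mul]
      rfl
    · rw [← Finset.sum_mul, sum_prod_eq_one _ fun j => hsum s hs j (b j), one_mul]
      simp only [ofTree, potential, NoisyTree.cost]
      positivity
  | query i γ l r ihl ihr =>
    intro s hs
    obtain ⟨γ, h0, h1⟩ := γ
    have hp : ∀ b a, 0 ≤ noisyOracleProb b γ a := fun b => noisyOracleProb_nonneg b h0 h1
    rcases le_or_gt (g / 2) γ with h | h
    -- A strong call is synthesized at cost 16γ² and leaves the posterior means untouched.
    · refine FamilyRealizes.mono (FamilyRealizes.branch (i := i)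
        (simulates_of_half_le hΓ h1Γ hg hg1 h h1) hp (hsum s hs) (ihl s hs) (ihr s hs)) rfl ?_
      intro b
      simp only [NoisyProfile.branch, potential, NoisyTree.cost]
      have := noisyOracleProb_add (b i) γ
      refine le_of_eq ?_
      linear_combination (4 * ∑ j, s j ^ 2) * this
    -- A weak call is free, and its budget 16γ² covers the expected growth 4·4γ² of the potential.
    · refine FamilyRealizes.mono (FamilyRealizes.simulate (i := i)
        (w' := fun a => auxWeight g (updateBias (s i) γ a)) hp
        (auxAnswer_nonneg hg hg1 (hs i) h0 h) (auxAnswer_add hg (hs i))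
        (auxWeight_mul_auxAnswer hg hg1 (hs i) h0 h)
        (familyRealizes_of_reset hΓ hg hg1 ihl hs i (abs_updateBias_lt hg hg1 (hs i) h0 h _))
        (familyRealizes_of_reset hΓ hg hg1 ihr hs i (abs_updateBias_lt hg hg1 (hs i) h0 h _)))
        rfl ?_
      intro b
      simp only [NoisyProfile.branch, potential, NoisyTree.cost, sum_update_sq]
      have h2 := noisyOracleProb_add (b i) γ
      have h3 := expect_updateBias_sq_le (s := s i) (γ := γ) ((hs i).trans (by linarith)) h0
        (by linarith) (b i)
      have h4 : noisyOracleProb (b i) γ true = 1 - noisyOracleProb (b i) γ false := by linarith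
      rw [h4] at h3 ⊢
      linarith

/-- Every tree can be simulated with the parameters `g` and `1`, with a constant overhead and an
additional cost of `n * g ^ 2`. -/
lemma realizable_of_tree {g : ℝ} (hΓ : g ∈ Γ) (h1Γ : 1 ∈ Γ) (hg : 0 < g) (hg1 : g ≤ 1)
    (D : NoisyTree n S) :
    ((fun b T => D.prob b T, fun b => n * g ^ 2 + 16 * D.cost b) : NoisyProfile n S) ∈
      realizable n S Γ := by
  have h := familyRealizes_potential hΓ h1Γ hg hg1 D (fun _ => 0)
    (fun _ => by simpa using (half_pos hg).le)
  have e : (fun _ : Fin n => auxWeight g 0) = fun _ b x => noisyOracleProb b g x := by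
    ext j b x
    exact auxWeight_zero g b x
  rw [e] at h
  refine realizable_mono (h.realizable (simulates_of_mem hΓ hg.le hg1)) rfl ?_
  intro b
  simp [potential]

end NoisyProfile

/-! ### A constant lower bound on the cost via affinity. -/

namespace NoisyTree

variable {n : ℕ} {S : Type*}

lemma prob_nonneg (D : NoisyTree n S) (x : Fin n → Bool) (T : Set S) : 0 ≤ D.prob x T := by
  induction D with
  | leaf a => exact Set.indicator_nonneg (fun _ _ => zero_le_one) a
  | query i γ l r ihl ihr =>
    have := noisyOracleProb_nonneg (x i) γ.2.1 γ.2.2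
    exact add_nonneg (mul_nonneg (this _) ihl) (mul_nonneg (this _) ihr)

lemma prob_add_le_one (D : NoisyTree n S) (x : Fin n → Bool) {T U : Set S} (h : Disjoint T U) :
    D.prob x T + D.prob x U ≤ 1 := by
  induction D with
  | leaf a =>
    simp only [prob]
    by_cases hT : a ∈ T
    · simp [hT, Set.disjoint_left.1 h hT]
    · rw [Set.indicator_of_notMem hT, zero_add]
      exact Set.indicator_le_self' (fun _ _ => zero_le_one) a
  | query i γ l r ihl ihr =>
    have h0 := noisyOracleProb_nonneg (x i) γ.2.1 γ.2.2 false
    have h1 := noisyOracleProb_nonneg (x i) γ.2.1 γ.2.2 true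
    have h2 := noisyOracleProb_add (x i) γ
    simp only [prob]
    nlinarith

lemma prob_le_one (D : NoisyTree n S) (x : Fin n → Bool) (T : Set S) : D.prob x T ≤ 1 := by
  have := D.prob_add_le_one x (disjoint_compl_right (a := T))
  linarith [D.prob_nonneg x Tᶜ]

lemma cost_nonneg (D : NoisyTree n S) (x : Fin n → Bool) : 0 ≤ D.cost x := by
  induction D with
  | leaf a => exact le_rfl
  | query i γ l r ihl ihr =>
    have := noisyOracleProb_nonneg (x i) γ.2.1 γ.2.2
    exact add_nonneg (sq_nonneg _) (add_nonneg (mul_nonneg (this _) ihl) (mul_nonneg (this _) ihr))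

end NoisyTree

/-- The affinity of two Bernoulli distributions. -/
def bernoulliAffinity (p q : ℝ) : ℝ := √p * √q + √(1 - p) * √(1 - q)

lemma bernoulliAffinity_self {p : ℝ} (h0 : 0 ≤ p) (h1 : p ≤ 1) : bernoulliAffinity p p = 1 := by
  rw [bernoulliAffinity, Real.mul_self_sqrt h0, Real.mul_self_sqrt (by linarith)]
  ring

/-- Mixing increases the affinity. -/
lemma sum_mul_bernoulliAffinity_le {ι : Type*} (t : Finset ι) {A B p q : ι → ℝ}
    (hA : ∀ i ∈ t, 0 ≤ A i) (hB : ∀ i ∈ t, 0 ≤ B i) (hA1 : ∑ i ∈ t, A i = 1)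
    (hB1 : ∑ i ∈ t, B i = 1) (hp : ∀ i ∈ t, 0 ≤ p i ∧ p i ≤ 1)
    (hq : ∀ i ∈ t, 0 ≤ q i ∧ q i ≤ 1) :
    ∑ i ∈ t, √(A i) * √(B i) * bernoulliAffinity (p i) (q i) ≤
      bernoulliAffinity (∑ i ∈ t, A i * p i) (∑ i ∈ t, B i * q i) := by
  have key : ∀ r s : ι → ℝ, (∀ i ∈ t, 0 ≤ r i) → (∀ i ∈ t, 0 ≤ s i) →
      ∑ i ∈ t, √(A i) * √(B i) * (√(r i) * √(s i)) ≤
        √(∑ i ∈ t, A i * r i) * √(∑ i ∈ t, B i * s i) := by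
    intro r s hr hs
    have h := Real.sum_mul_le_sqrt_mul_sqrt t (fun i => √(A i) * √(r i))
      (fun i => √(B i) * √(s i))
    have e1 : ∑ i ∈ t, (√(A i) * √(r i)) ^ 2 = ∑ i ∈ t, A i * r i :=
      Finset.sum_congr rfl fun i hi => by
        rw [mul_pow, Real.sq_sqrt (hA i hi), Real.sq_sqrt (hr i hi)]
    have e2 : ∑ i ∈ t, (√(B i) * √(s i)) ^ 2 = ∑ i ∈ t, B i * s i :=
      Finset.sum_congr rfl fun i hi => by
        rw [mul_pow, Real.sq_sqrt (hB i hi), Real.sq_sqrt (hs i hi)]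
    rw [e1, e2] at h
    refine le_trans (le_of_eq (Finset.sum_congr rfl fun i _ => by ring)) h
  have h1 := key p q (fun i hi => (hp i hi).1) fun i hi => (hq i hi).1
  have h2 := key (fun i => 1 - p i) (fun i => 1 - q i) (fun i hi => sub_nonneg.2 (hp i hi).2)
    fun i hi => sub_nonneg.2 (hq i hi).2
  simp only [mul_sub, mul_one, Finset.sum_sub_distrib, hA1, hB1] at h2
  refine le_trans (le_of_eq ?_) (add_le_add h1 h2)
  rw [← Finset.sum_add_distrib]
  refine Finset.sum_congr rfl fun i _ => ?_
  rw [bernoulliAffinity]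
  ring

/-- Cauchy–Schwarz with crossed pairing bounds the squared affinity by 1 − (p−q)²; then 2A ≤ 1 + A².
-/
lemma bernoulliAffinity_le {p q d : ℝ} (hp : p ≤ 1) (hq : 0 ≤ q) (hd : 0 ≤ d) (hpq : d ≤ p - q) :
    bernoulliAffinity p q ≤ 1 - d ^ 2 / 2 := by
  have h1 := Real.sq_sqrt (show 0 ≤ p by linarith)
  have h2 := Real.sq_sqrt hq
  have h3 := Real.sq_sqrt (show 0 ≤ 1 - p by linarith)
  have h4 := Real.sq_sqrt (show 0 ≤ 1 - q by linarith)
  have h5 : bernoulliAffinity p q ^ 2 ≤ (q + (1 - p)) * (p + (1 - q)) := by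
    rw [bernoulliAffinity]
    have : (q + (1 - p)) * (p + (1 - q)) = (√q ^ 2 + √(1 - p) ^ 2) * (√p ^ 2 + √(1 - q) ^ 2) := by
      rw [h1, h2, h3, h4]
    rw [this]
    nlinarith [sq_nonneg (√q * √(1 - q) - √(1 - p) * √p)]
  nlinarith [sq_nonneg (bernoulliAffinity p q - 1)]

/-- The sum is 1 for equal bits and √(1−γ²) ≥ 1−γ² for different ones. -/
lemma one_sub_sum_sqrt_le (a b : Bool) {γ : ℝ} (h0 : 0 ≤ γ) (h1 : γ ≤ 1) :
    1 - ∑ c, √(noisyOracleProb a γ c) * √(noisyOracleProb b γ c) ≤ γ ^ 2 := by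
  have hp := Real.mul_self_sqrt (show 0 ≤ (1 + γ) / 2 by linarith)
  have hm := Real.mul_self_sqrt (show 0 ≤ (1 - γ) / 2 by linarith)
  have hp0 := Real.sqrt_nonneg ((1 + γ) / 2)
  have hm0 := Real.sqrt_nonneg ((1 - γ) / 2)
  have hpm : 2 * ((1 + γ) / 2 * ((1 - γ) / 2)) ≤ √((1 + γ) / 2) * √((1 - γ) / 2) := by
    generalize √((1 + γ) / 2) = r at *
    generalize √((1 - γ) / 2) = s at *
    rw [← hp, ← hm]
    have : r * s ≤ 1 / 2 := by nlinarith [sq_nonneg (r - s)]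
    nlinarith [mul_nonneg hp0 hm0]
  rw [Fintype.sum_bool]
  cases a <;> cases b <;>
    simp only [noisyOracleProb, if_true, Bool.false_eq_true, Bool.true_eq_false, if_false] <;>
    nlinarith [sq_nonneg γ]

namespace NoisyTree

variable {n : ℕ} {S : Type*}

/-- A tree that distinguishes two inputs has to spend something on them. -/
lemma one_sub_affinity_le_cost (D : NoisyTree n S) (x y : Fin n → Bool) (T : Set S) :
    ∀ a b : ℝ, 0 ≤ a → 0 ≤ b → a * b * (1 - bernoulliAffinity (D.prob x T) (D.prob y T)) ≤
      (a ^ 2 * D.cost x + b ^ 2 * D.cost y) / 2 := by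
  induction D with
  | leaf c =>
    intro a b _ _
    have h : (leaf c : NoisyTree n S).prob x T = (leaf c : NoisyTree n S).prob y T := rfl
    rw [h, bernoulliAffinity_self (prob_nonneg _ _ _) (prob_le_one _ _ _)]
    simp [cost]
  | query i γ l r ihl ihr =>
    intro a b ha hb
    obtain ⟨γ, h0, h1⟩ := γ
    have hx := noisyOracleProb_nonneg (x i) h0 h1
    have hy := noisyOracleProb_nonneg (y i) h0 h1
    have hx1 := noisyOracleProb_add (x i) γ
    have hy1 := noisyOracleProb_add (y i) γ
    have hmix := sum_mul_bernoulliAffinity_le Finset.univ (A := noisyOracleProb (x i) γ)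
      (B := noisyOracleProb (y i) γ) (p := fun c => if c then r.prob x T else l.prob x T)
      (q := fun c => if c then r.prob y T else l.prob y T) (fun c _ => hx c) (fun c _ => hy c)
      (by rw [Fintype.sum_bool]; linarith) (by rw [Fintype.sum_bool]; linarith)
      (fun c _ => by cases c <;> simp [prob_nonneg, prob_le_one])
      (fun c _ => by cases c <;> simp [prob_nonneg, prob_le_one])
    have hone := one_sub_sum_sqrt_le (x i) (y i) h0 h1
    simp only [Fintype.sum_bool, if_true, Bool.false_eq_true, if_false] at hmix hone
    -- The weights a and b accumulate the square roots of the probabilities of reaching a node on x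
    -- and on y. These differ, so each charge a·b·γ² is split by AM–GM into shares of the two
    -- expected costs.
    have hl := ihl (a * √(noisyOracleProb (x i) γ false)) (b * √(noisyOracleProb (y i) γ false))
      (by positivity) (by positivity)
    have hr := ihr (a * √(noisyOracleProb (x i) γ true)) (b * √(noisyOracleProb (y i) γ true))
      (by positivity) (by positivity)
    simp only [mul_pow, Real.sq_sqrt (hx _), Real.sq_sqrt (hy _)] at hl hr
    simp only [prob, cost]
    rw [add_comm (noisyOracleProb (x i) γ false * l.prob x T),
      add_comm (noisyOracleProb (y i) γ false * l.prob y T)]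
    have hab : 0 ≤ a * b := mul_nonneg ha hb
    have e1 := mul_le_mul_of_nonneg_left hmix hab
    have e2 := mul_le_mul_of_nonneg_left hone hab
    have e3 : a * b * γ ^ 2 ≤ (a ^ 2 + b ^ 2) / 2 * γ ^ 2 :=
      mul_le_mul_of_nonneg_right (by nlinarith [sq_nonneg (a - b)]) (sq_nonneg γ)
    linarith

end NoisyTree

namespace NoisyAlg

variable {n : ℕ} {S : Type*}

lemma sum_weights (R : NoisyAlg n S) : ∑ D ∈ R.weights.support, R.weights D = 1 := R.total

lemma cost_nonneg (R : NoisyAlg n S) (x : Fin n → Bool) : 0 ≤ R.cost x :=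
  Finset.sum_nonneg fun D _ => mul_nonneg (R.nonneg D) (D.cost_nonneg x)

lemma prob_nonneg (R : NoisyAlg n S) (x : Fin n → Bool) (T : Set S) : 0 ≤ R.prob x T :=
  Finset.sum_nonneg fun D _ => mul_nonneg (R.nonneg D) (D.prob_nonneg x T)

lemma prob_add_le_one (R : NoisyAlg n S) (x : Fin n → Bool) {T U : Set S} (h : Disjoint T U) :
    R.prob x T + R.prob x U ≤ 1 := by
  rw [← R.sum_weights]
  simp only [prob, Finsupp.sum]
  rw [← Finset.sum_add_distrib]
  refine Finset.sum_le_sum fun D _ => ?_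
  rw [← mul_add]
  exact mul_le_of_le_one_right (R.nonneg D) (D.prob_add_le_one x h)

lemma one_sub_affinity_le_cost (R : NoisyAlg n S) (x y : Fin n → Bool) (T : Set S) :
    1 - bernoulliAffinity (R.prob x T) (R.prob y T) ≤ (R.cost x + R.cost y) / 2 := by
  have hmix := sum_mul_bernoulliAffinity_le R.weights.support (A := R.weights) (B := R.weights)
    (p := fun D => D.prob x T) (q := fun D => D.prob y T) (fun D _ => R.nonneg D)
    (fun D _ => R.nonneg D) R.sum_weights R.sum_weights
    (fun D _ => ⟨D.prob_nonneg x T, D.prob_le_one x T⟩)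
    (fun D _ => ⟨D.prob_nonneg y T, D.prob_le_one y T⟩)
  simp only [Real.mul_self_sqrt (R.nonneg _)] at hmix
  have h : ∑ D ∈ R.weights.support,
      R.weights D * (1 - bernoulliAffinity (D.prob x T) (D.prob y T)) ≤
      ∑ D ∈ R.weights.support, R.weights D * ((D.cost x + D.cost y) / 2) := by
    refine Finset.sum_le_sum fun D _ => mul_le_mul_of_nonneg_left ?_ (R.nonneg D)
    have := D.one_sub_affinity_le_cost x y T 1 1 zero_le_one zero_le_one
    linarith
  simp only [mul_sub, mul_one, Finset.sum_sub_distrib, R.sum_weights] at h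
  have e : ∑ D ∈ R.weights.support, R.weights D * ((D.cost x + D.cost y) / 2) =
      (R.cost x + R.cost y) / 2 := by
    simp only [cost, Finsupp.sum]
    rw [← Finset.sum_add_distrib, Finset.sum_div]
    exact Finset.sum_congr rfl fun D _ => by ring
  rw [e] at h
  change 1 - bernoulliAffinity (∑ D ∈ R.weights.support, R.weights D * D.prob x T)
    (∑ D ∈ R.weights.support, R.weights D * D.prob y T) ≤ _
  linarith

lemma cost_le_worstCost (R : NoisyAlg n S) {f : SetRel (Fin n → Bool) S} {x : Fin n → Bool}
    (hx : x ∈ f.dom) : R.cost x ≤ R.worstCost f :=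
  le_ciSup (f := fun x : f.dom => R.cost x) (Set.finite_range _).bddAbove ⟨x, hx⟩

lemma worstCost_nonneg (R : NoisyAlg n S) (f : SetRel (Fin n → Bool) S) : 0 ≤ R.worstCost f :=
  Real.iSup_nonneg fun _ => R.cost_nonneg _

/-- An algorithm for a relation that is not constant has cost bounded below. -/
lemma Computes.le_worstCost {R : NoisyAlg n S} {f : SetRel (Fin n → Bool) S} {ε : ℝ}
    (h : R.Computes f ε) (hε : ε < 1 / 2) {x y : Fin n → Bool} (hx : x ∈ f.dom) (hy : y ∈ f.dom)
    (hxy : Disjoint {a | (x, a) ∈ f} {a | (y, a) ∈ f}) :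
    (1 - 2 * ε) ^ 2 / 2 ≤ R.worstCost f := by
  have h1 := h x hx
  have h2 := h y hy
  have h3 := R.prob_add_le_one y hxy
  have h4 := R.prob_add_le_one x (T := {a | (x, a) ∈ f}) (U := ∅) (Set.disjoint_empty _)
  have h5 := R.prob_nonneg x ∅
  have h6 := bernoulliAffinity_le (p := R.prob x {a | (x, a) ∈ f})
    (q := R.prob y {a | (x, a) ∈ f}) (d := 1 - 2 * ε) (by linarith) (R.prob_nonneg _ _)
    (by linarith) (by linarith)
  have h7 := R.one_sub_affinity_le_cost x y {a | (x, a) ∈ f}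
  have := R.cost_le_worstCost hx
  have := R.cost_le_worstCost hy
  linarith

end NoisyAlg

/-! ### From profiles back to algorithms, and the comparison with the optimum. -/

namespace NoisyProfile

variable {n : ℕ} {S : Type*} {Γ : Set ℝ}

lemma exists_alg_of_mem_realizable {v : NoisyProfile n S} (hv : v ∈ realizable n S Γ) :
    ∃ A : NoisyAlg n S, A.UsesOnly Γ ∧ (∀ x T, A.prob x T = v.1 x T) ∧
      ∀ x, A.cost x ≤ v.2 x := by
  obtain ⟨u, hu, e, l⟩ := hv
  have key : convexHull ℝ (ofTree '' {D : NoisyTree n S | D.params ⊆ Γ}) ⊆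
      {u | ∃ A : NoisyAlg n S, A.UsesOnly Γ ∧ (∀ x T, A.prob x T = u.1 x T) ∧
        ∀ x, A.cost x = u.2 x} := by
    classical
    refine convexHull_min ?_ ?_
    · rintro _ ⟨D, hD, rfl⟩
      refine ⟨Convexity.StdSimplex.single D, ?_, ?_, ?_⟩
      · intro E hE
        have : E = D := by simpa [Finsupp.single_apply, eq_comm] using hE
        exact this ▸ hD
      · intro x T
        simp [NoisyAlg.prob, ofTree]
      · intro x
        simp [NoisyAlg.cost, ofTree]
    · rintro u ⟨A, hA, hAp, hAc⟩ v ⟨B, hB, hBp, hBc⟩ a b ha hb hab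
      have hsum : ∀ F : NoisyTree n S → ℝ,
          (a • A.weights + b • B.weights).sum (fun D w => w * F D) =
            a * A.weights.sum (fun D w => w * F D) + b * B.weights.sum (fun D w => w * F D) := by
        intro F
        rw [Finsupp.sum_add_index' (by simp) (by intros; ring), Finsupp.sum_smul_index (by simp),
          Finsupp.sum_smul_index (by simp), Finsupp.mul_sum, Finsupp.mul_sum]
        simp only [mul_assoc]
      refine ⟨⟨a • A.weights + b • B.weights,
        add_nonneg (smul_nonneg ha A.nonneg) (smul_nonneg hb B.nonneg), ?_⟩, ?_, ?_, ?_⟩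
      · have := hsum fun _ => 1
        simp only [mul_one, A.total, B.total, hab] at this
        exact this
      · intro D hD
        rcases Finset.mem_union.1 (Finsupp.support_add hD) with h | h
        · exact hA D (Finsupp.support_smul h)
        · exact hB D (Finsupp.support_smul h)
      · intro x T
        have := hsum fun D => D.prob x T
        simp only [NoisyAlg.prob] at hAp hBp ⊢
        simpa [hAp, hBp] using this
      · intro x
        have := hsum fun D => D.cost x
        simp only [NoisyAlg.cost] at hAc hBc ⊢
        simpa [hAc, hBc] using this
  obtain ⟨A, h1, h2, h3⟩ := key hu
  exact ⟨A, h1, fun x T => by rw [h2, e], fun x => (h3 x).le.trans (l x)⟩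

end NoisyProfile

namespace NoisyAlg

variable {n : ℕ} {S : Type*}

/-- Every algorithm can be simulated with the parameters `1 / √n` and `1`. -/
lemma exists_simulation (hn : 1 ≤ n) (R : NoisyAlg n S) :
    ∃ A : NoisyAlg n S, A.UsesOnly {1 / √(n : ℝ), 1} ∧ (∀ x T, A.prob x T = R.prob x T) ∧
      ∀ x, A.cost x ≤ 1 + 16 * R.cost x := by
  have hn' : (1 : ℝ) ≤ n := by exact_mod_cast hn
  have hs : 1 ≤ √(n : ℝ) := Real.one_le_sqrt.2 hn'
  have hg : 0 < 1 / √(n : ℝ) := by positivity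
  -- This choice of g makes the initial purchase of n auxiliary bits cost exactly 1.
  have hsq : n * (1 / √(n : ℝ)) ^ 2 = 1 := by
    rw [div_pow, one_pow, Real.sq_sqrt (by linarith)]
    field_simp
  have h := NoisyProfile.convex_realizable.sum_mem (t := R.weights.support) (w := R.weights)
    (fun D _ => R.nonneg D) R.sum_weights fun D _ =>
      NoisyProfile.realizable_of_tree (Γ := {1 / √(n : ℝ), 1}) (by simp) (by simp) hg
        ((div_le_one (by positivity)).2 hs) D
  obtain ⟨A, hA, hp, hc⟩ := NoisyProfile.exists_alg_of_mem_realizable h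
  refine ⟨A, hA, fun x T => ?_, fun x => (hc x).trans (le_of_eq ?_)⟩
  · rw [hp]
    simp [Prod.fst_sum, prob, Finsupp.sum]
  · simp only [hsq, Prod.snd_sum, Finset.sum_apply, Prod.smul_snd, Pi.smul_apply, smul_eq_mul,
      mul_add, mul_one, Finset.sum_add_distrib, R.sum_weights, cost, Finsupp.sum, Finset.mul_sum]
    congr 1
    exact Finset.sum_congr rfl fun D _ => by ring

/-- Every function is computed without error by querying all bits. -/
lemma exists_prob_eq_indicator (g : (Fin n → Bool) → S) :
    ∃ A : NoisyAlg n S, ∀ x T, A.prob x T = T.indicator 1 (g x) := by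
  -- Auxiliary bits of parameter 1 are the input itself, so leaves labelled by g(X) suffice.
  have hfam : NoisyProfile.FamilyRealizes (n := n) (S := S) {1}
      (fun _ b x => noisyOracleProb b 1 x) (fun x T => T.indicator 1 (g x), 0) := by
    have hone : ∀ (b : Fin n → Bool) (G : (Fin n → Bool) → ℝ),
        ∑ X : Fin n → Bool, (∏ j, noisyOracleProb (b j) 1 (X j)) * G X = G b := by
      intro b G
      rw [Finset.sum_eq_single b]
      · simp [noisyOracleProb]
      · intro X _ hX
        obtain ⟨j, hj⟩ := Function.ne_iff.1 hX
        rw [Finset.prod_eq_zero (Finset.mem_univ j) (by simp [noisyOracleProb, hj]), zero_mul]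
      · simp
    refine ⟨fun X => NoisyProfile.ofTree (NoisyTree.leaf (g X)), fun X =>
      NoisyProfile.ofTree_mem_realizable (by simp [NoisyTree.params]), fun b => ⟨fun T => ?_, ?_⟩⟩
    · rw [hone b]
      rfl
    · rw [hone b]
      rfl
  obtain ⟨A, -, hp, -⟩ := NoisyProfile.exists_alg_of_mem_realizable
    (hfam.realizable (NoisyProfile.simulates_of_mem (Set.mem_singleton 1) zero_le_one le_rfl))
  exact ⟨A, hp⟩

/-- Keeps the infimum defining `noisyRError` from ranging over an empty family, where it would be 0
by default and the lower bound would fail. -/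
lemma exists_computes {f : SetRel (Fin n → Bool) S} (hf : f.dom.Nonempty) {ε : ℝ} (hε : 0 ≤ ε) :
    ∃ A : NoisyAlg n S, A.Computes f ε := by
  classical
  obtain ⟨x₀, a₀, -⟩ := hf
  obtain ⟨A, hA⟩ := exists_prob_eq_indicator (n := n) fun x =>
    if h : x ∈ f.dom then h.choose else a₀
  refine ⟨A, fun x hx => ?_⟩
  rw [hA, dif_pos hx, Set.indicator_of_mem (show hx.choose ∈ {a | (x, a) ∈ f} from hx.choose_spec)]
  simpa using hε

lemma exists_le_noisyRError {ε : ℝ} (h0 : 0 ≤ ε) (h1 : ε < 1 / 2) (hn : 1 ≤ n)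
    (f : SetRel (Fin n → Bool) S)
    (hf : ∃ x ∈ f.dom, ∃ y ∈ f.dom, Disjoint {a | (x, a) ∈ f} {a | (y, a) ∈ f}) :
    ∃ A : NoisyAlg n S, A.Computes f ε ∧ A.UsesOnly {1 / √(n : ℝ), 1} ∧
      A.worstCost f ≤ 2 * (2 / (1 - 2 * ε) ^ 2 + 16) * noisyRError ε f := by
  obtain ⟨x, hx, y, hy, hxy⟩ := hf
  have hc : 0 < (1 - 2 * ε) ^ 2 / 2 := by
    have : 0 < 1 - 2 * ε := by linarith
    positivity
  obtain ⟨R₀, hR₀⟩ := exists_computes ⟨x, hx⟩ h0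
  have : Nonempty {R : NoisyAlg n S // R.Computes f ε} := ⟨⟨R₀, hR₀⟩⟩
  have hinf : (1 - 2 * ε) ^ 2 / 2 ≤ noisyRError ε f :=
    le_ciInf fun R => R.2.le_worstCost h1 hx hy hxy
  -- The infimum need not be attained; since it is positive, some R is within a factor 2 of it.
  obtain ⟨⟨R, hR⟩, hlt⟩ := exists_lt_of_ciInf_lt
    (show (⨅ R : {R : NoisyAlg n S // R.Computes f ε}, R.1.worstCost f) < 2 * noisyRError ε f by
      change noisyRError ε f < _
      linarith)
  obtain ⟨A, hA, hp, hcost⟩ := R.exists_simulation hn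
  refine ⟨A, fun z hz => by rw [hp]; exact hR z hz, hA, ?_⟩
  have hw := hR.le_worstCost h1 hx hy hxy
  have : Nonempty f.dom := ⟨⟨x, hx⟩⟩
  have hle : A.worstCost f ≤ 1 + 16 * R.worstCost f :=
    ciSup_le fun z => (hcost z).trans (by linarith [R.cost_le_worstCost z.2])
  have hk : 1 ≤ 2 / (1 - 2 * ε) ^ 2 * R.worstCost f := by
    rw [div_mul_eq_mul_div, le_div_iff₀ (by linarith)]
    linarith
  have hk0 : 0 ≤ 2 / (1 - 2 * ε) ^ 2 := by positivity
  have := mul_le_mul_of_nonneg_left hlt.le (by linarith : 0 ≤ 2 / (1 - 2 * ε) ^ 2 + 16)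
  linarith

/-- A constant relation is computed at no cost. -/
lemma exists_of_common_output {ε : ℝ} (hε : 0 ≤ ε) (f : SetRel (Fin n → Bool) S) (Γ : Set ℝ)
    (a : S) (ha : ∀ x ∈ f.dom, (x, a) ∈ f) :
    ∃ A : NoisyAlg n S, A.Computes f ε ∧ A.UsesOnly Γ ∧ A.worstCost f ≤ 0 := by
  obtain ⟨A, hA, hp, hc⟩ := NoisyProfile.exists_alg_of_mem_realizable
    (NoisyProfile.ofTree_mem_realizable (n := n) (Γ := Γ) (D := NoisyTree.leaf a)
      (by simp [NoisyTree.params]))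
  refine ⟨A, fun x hx => ?_, hA, Real.iSup_nonpos fun x => hc x⟩
  rw [hp]
  simp [NoisyProfile.ofTree, NoisyTree.prob, ha x hx, hε]

end NoisyAlg

end

theorem mainTheorem8 :
    (∃ C : ℝ, 0 < C ∧ ∀ (n : ℕ), 1 ≤ n → ∀ f : PartialBoolFun n,
      ∃ A : NoisyAlg n Bool,
        A.Computes f.graph (1 / 3) ∧
        A.UsesOnly {1 / Real.sqrt n, 1} ∧
        A.worstCost f.graph ≤ C * noisyR f) ∧
    (∀ ε : ℝ, 0 ≤ ε → ε < 1 / 2 →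
      ∃ C : ℝ, 0 < C ∧ ∀ (n : ℕ), 1 ≤ n → ∀ (S : Type*) [Finite S]
        (f : SetRel (Fin n → Bool) S),
        (∃ x ∈ f.dom, ∃ y ∈ f.dom, Disjoint {a | (x, a) ∈ f} {a | (y, a) ∈ f}) →
        ∃ A : NoisyAlg n S,
          A.Computes f ε ∧
          A.UsesOnly {1 / Real.sqrt n, 1} ∧
          A.worstCost f ≤ C * noisyRError ε f) := by
  refine ⟨⟨2 * (2 / (1 - 2 * (1 / 3)) ^ 2 + 16), by positivity, fun n hn f => ?_⟩,
    fun ε h0 h1 => ⟨2 * (2 / (1 - 2 * ε) ^ 2 + 16), by positivity, fun n hn S _ f hf =>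
      NoisyAlg.exists_le_noisyRError h0 h1 hn f hf⟩⟩
  by_cases hf : ∃ x ∈ SetRel.dom f.graph, ∃ y ∈ SetRel.dom f.graph,
      Disjoint {a | (x, a) ∈ f.graph} {a | (y, a) ∈ f.graph}
  · exact NoisyAlg.exists_le_noisyRError (by norm_num) (by norm_num) hn _ hf
  -- Allowed sets of a partial function are singletons on its domain, so without a disjoint pair f
  -- is constant there (or nowhere defined) and a single leaf computes it for free.
  · obtain ⟨a, ha⟩ : ∃ a : Bool, ∀ x ∈ SetRel.dom f.graph, (x, a) ∈ f.graph := by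
      by_cases hd : ∃ x a, (x, a) ∈ f.graph
      · obtain ⟨x, a, hxa⟩ := hd
        refine ⟨a, fun y hy => ?_⟩
        by_contra hya
        refine hf ⟨x, ⟨a, hxa⟩, y, hy, Set.disjoint_left.2 fun c hc hc' => hya ?_⟩
        rwa [Part.mem_unique (show a ∈ f x from hxa) hc]
      · exact ⟨true, fun x ⟨a, hxa⟩ => absurd ⟨x, a, hxa⟩ hd⟩
    obtain ⟨A, h1, h2, h3⟩ := NoisyAlg.exists_of_common_output (ε := 1 / 3) (by norm_num) f.graph
      {1 / Real.sqrt n, 1} a ha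
    refine ⟨A, h1, h2, h3.trans (mul_nonneg (by positivity) ?_)⟩
    exact Real.iInf_nonneg fun R => R.1.worstCost_nonneg _
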